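/- For a positive integer $N$ put $\eta=1/N$. Let $B$ be a standard Brownian motion in $\mathbb R^3$ with $B_0=0$, and let $\mathbb P^{(\eta)}$ be the law on $C([0,1];\mathbb R^3)$ of the continuous process that agrees with $B$ at the times $0,\eta,2\eta,\dots,1$ and is affine on each interval $[k\eta,(k+1)\eta]$. For $\beta\ge 0$ let $\widetilde{\mathbb P}^{(\eta)}_{\beta}$ be the probability measure on $C([0,1];\mathbb R^3)$ given by $$\frac{d\widetilde{\mathbb P}^{(\eta)}_{\beta}}{d\mathbb P^{(\eta)}}(B)=\frac{1}{Z}\exp\Big(-\beta\int_0^1\!\!\int_0^1\|B_t-B_s\|^2\,dt\,ds\Big),\qquad Z=\mathbb E^{\mathbb P^{(\eta)}}\Big[\exp\Big(-\beta\int_0^1\!\!\int_0^1\|B_t-B_s\|^2\,dt\,ds\Big)\Big].$$ There is an absolute constant $C>0$ such that for every $\beta\ge 2$ there is $\eta_0=\eta_0(\beta)>0$ such that for all $\eta=1/N\le\eta_0$, $$\sup_{t\in[0,1]}\ \mathbb E^{\widetilde{\mathbb P}^{(\eta)}_{\beta}}\big[\|B_t\|^2\big]\le \frac{C}{\sqrt\beta}.$$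 -/

import Mathlib

open MeasureTheory ProbabilityTheory
open scoped NNReal ENNReal

noncomputable section

namespace ConfinedBM

/-- Three-dimensional Euclidean space. -/
abbrev E3 : Type := EuclideanSpace ℝ (Fin 3)

/-- The path space `C([0,1]; ℝ³)` with the topology of uniform convergence. -/
abbrev Path3 : Type := C(unitInterval, E3)

/-- Path space carries its Borel sigma-algebra. -/
instance instMeasurableSpacePath3 : MeasurableSpace Path3 := borel _

instance instBorelSpacePath3 : BorelSpace Path3 := ⟨rfl⟩

/-- The piecewise-linear nodal ("hat") function of the grid `(1/N)ℤ` at the node `k/N`. -/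
def hat (N k : ℕ) (t : ℝ) : ℝ := max 0 (1 - |(N : ℝ) * t - (k : ℝ)|)

/-- The path on `[0,1]` that takes the value `x k` at the time `k/N` for `k = 0, …, N` and is
affine on every interval `[k/N, (k+1)/N]` (see `interpolate_apply`). -/
def interpolate (N : ℕ) (x : Fin (N + 1) → E3) : Path3 where
  toFun t := ∑ k : Fin (N + 1), hat N k t • x k
  continuous_toFun := by unfold hat; fun_prop

theorem interpolate_apply (N : ℕ) (x : Fin (N + 1) → E3) (k : Fin N) (u : ℝ) (t : unitInterval)
    (hu : u ∈ Set.Icc (0 : ℝ) 1) (ht : (N : ℝ) * t = k + u) :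
    interpolate N x t = (1 - u) • x k.castSucc + u • x k.succ := by
  have hne : k.castSucc ≠ k.succ := by simp [Fin.ext_iff]
  change ∑ j : Fin (N + 1), hat N j t • x j = _
  rw [← Finset.sum_subset (Finset.subset_univ {k.castSucc, k.succ}), Finset.sum_pair hne]
  · have h0 : |u| = u := abs_of_nonneg hu.1
    have h1 : |u - 1| = 1 - u := by rw [abs_sub_comm, abs_of_nonneg (by linarith [hu.2])]
    have e0 : (k : ℝ) + u - k = u := by ring
    have e1 : (k : ℝ) + u - (k + 1) = u - 1 := by ring
    simp [hat, ht, e0, e1, h0, h1, hu.1, hu.2]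
  · intro j _ hj
    have hj1 : (j : ℕ) ≠ k := by
      intro h; apply hj; simp [Fin.ext_iff, h]
    have hj2 : (j : ℕ) ≠ k + 1 := by
      intro h; apply hj; simp [Fin.ext_iff, h]
    have : hat N j t = 0 := by
      unfold hat
      rw [ht]
      apply max_eq_left
      rcases lt_or_gt_of_ne hj1 with h | h
      · have h' : ((j : ℕ) : ℝ) + 1 ≤ (k : ℕ) := by exact_mod_cast h
        have := le_abs_self ((k : ℝ) + u - (j : ℕ))
        linarith [hu.1]
      · have h' : ((k : ℕ) : ℝ) + 2 ≤ (j : ℕ) := by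
          have : (k : ℕ) + 2 ≤ (j : ℕ) := by omega
          exact_mod_cast this
        have := neg_le_abs ((k : ℝ) + u - (j : ℕ))
        linarith [hu.2]
    rw [this, zero_smul]

/-- The walk `0, ξ₀, ξ₀ + ξ₁, …` in `ℝ³` whose `i`-th coordinate has the increments
`ξ i 0, …, ξ i (N-1)`. -/
def walk (N : ℕ) (ξ : Fin 3 → Fin N → ℝ) (k : Fin (N + 1)) : E3 :=
  WithLp.toLp 2 fun i ↦ Fin.partialSum (ξ i) k

/-- The law of `3N` independent `N(0, 1/N)` variables: the increments over the grid `(1/N)ℤ` of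
the coordinates of a Brownian motion in `ℝ³`. -/
def incrementLaw (N : ℕ) : Measure (Fin 3 → Fin N → ℝ) :=
  Measure.pi fun _ ↦ Measure.pi fun _ ↦ gaussianReal 0 (N : ℝ≥0)⁻¹

/-- The discretized Wiener measure `ℙ^(η)` on `C([0,1]; ℝ³)`, with `η = 1/N`: the law of the
piecewise-linear process that agrees with a standard Brownian motion started at the origin at all
times in `η ℤ` (see `map_interpolate_brownian`). -/
def discreteWiener (N : ℕ) : Measure Path3 :=
  (incrementLaw N).map fun ξ ↦ interpolate N (walk N ξ)

/-- The quadratic form `Q(B) = ∫₀¹ ∫₀¹ ‖B_t - B_s‖² dt ds`. -/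
def confinement (B : Path3) : ℝ :=
  ∫ s : unitInterval, ∫ t : unitInterval, ‖B t - B s‖ ^ 2

/-- The reweighted law: the probability measure with density
`exp (-β Q(B)) / 𝔼[exp (-β Q)]` with respect to `ℙ^(η)`, where `η = 1/N`. -/
def confinedLaw (N : ℕ) (β : ℝ) : Measure Path3 :=
  (discreteWiener N).tilted fun B ↦ -(β * confinement B)

/-! ### The definitions are as announced -/

theorem continuous_interpolate (N : ℕ) : Continuous (interpolate N) := by
  apply ContinuousMap.continuous_of_continuous_uncurry
  change Continuous fun p : (Fin (N + 1) → E3) × unitInterval ↦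
    ∑ k : Fin (N + 1), hat N k p.2 • p.1 k
  unfold hat
  fun_prop

theorem measurable_partialSum (N : ℕ) (k : Fin (N + 1)) :
    Measurable fun x : Fin N → ℝ ↦ Fin.partialSum x k := by
  induction k using Fin.induction with
  | zero => simp
  | succ j ih => simp only [Fin.partialSum_succ]; fun_prop

theorem measurable_path (N : ℕ) :
    Measurable fun ξ : Fin 3 → Fin N → ℝ ↦ interpolate N (walk N ξ) := by
  refine (continuous_interpolate N).measurable.comp (measurable_pi_lambda _ fun k ↦ ?_)
  refine (WithLp.measurable_toLp 2 _).comp (measurable_pi_lambda _ fun i ↦ ?_)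
  exact (measurable_partialSum N k).comp (measurable_pi_apply i)

instance instProbDiscreteWiener (N : ℕ) : IsProbabilityMeasure (discreteWiener N) := by
  have : IsProbabilityMeasure (incrementLaw N) := by unfold incrementLaw; infer_instance
  exact Measure.isProbabilityMeasure_map (measurable_path N).aemeasurable

theorem continuous_confinement : Continuous confinement := by
  have h1 : Continuous fun p : (Path3 × unitInterval) ↦
      ∫ t : unitInterval, ‖p.1 t - p.1 p.2‖ ^ 2 := by
    rw [← continuousOn_univ]
    exact continuousOn_integral_of_compact_support (k := Set.univ)
      (f := fun (p : Path3 × unitInterval) (t : unitInterval) ↦ ‖p.1 t - p.1 p.2‖ ^ 2)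
      isCompact_univ (Continuous.continuousOn (by unfold Function.uncurry; fun_prop)) (by simp)
  rw [← continuousOn_univ]
  exact continuousOn_integral_of_compact_support (k := Set.univ)
    (f := fun (B : Path3) (s : unitInterval) ↦ ∫ t : unitInterval, ‖B t - B s‖ ^ 2)
    isCompact_univ h1.continuousOn (by simp)

theorem confinement_nonneg (B : Path3) : 0 ≤ confinement B :=
  integral_nonneg fun _ ↦ integral_nonneg fun _ ↦ by positivity

/-- The normalizing constant is finite and positive, so the reweighted law is indeed a
probability measure. -/
theorem isProbabilityMeasure_confinedLaw (N : ℕ) {β : ℝ} (hβ : 0 ≤ β) :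
    IsProbabilityMeasure (confinedLaw N β) := by
  apply isProbabilityMeasure_tilted
  have hc := continuous_confinement
  refine Integrable.of_bound (C := 1) (Continuous.aestronglyMeasurable (by fun_prop))
    (Filter.Eventually.of_forall fun B ↦ ?_)
  rw [Real.norm_of_nonneg (Real.exp_pos _).le, Real.exp_le_one_iff]
  have := mul_nonneg hβ (confinement_nonneg B)
  linarith

/-- If `B¹, B², B³` are independent standard real Brownian motions, then `discreteWiener N` is the
law of the piecewise-linear path that agrees with `(B¹, B², B³)` at the times `0, 1/N, …, 1`. -/
theorem map_interpolate_brownian {Ω : Type*} [MeasurableSpace Ω] (P : Measure Ω)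
    (B : Fin 3 → ℝ≥0 → Ω → ℝ) (hB : ∀ i, IsBrownianReal (B i) P)
    (hind : iIndepFun (fun i ω t ↦ B i t ω) P) (N : ℕ) (hN : 0 < N) :
    P.map (fun ω ↦ interpolate N fun k ↦
      WithLp.toLp 2 fun i ↦ B i ((k : ℕ) / (N : ℝ≥0)) ω) = discreteWiener N := by
  have hNpos : (0 : ℝ≥0) < N := by exact_mod_cast hN
  let τ : Fin (N + 1) → ℝ≥0 := fun k ↦ (k : ℕ) / (N : ℝ≥0)
  have hτ : Monotone τ := fun a b hab ↦ by
    have : ((a : ℕ) : ℝ≥0) ≤ (b : ℕ) := by exact_mod_cast hab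
    simp only [τ]; gcongr
  let D : Fin 3 → Fin N → Ω → ℝ := fun i j ω ↦ B i (τ j.succ) ω - B i (τ j.castSucc) ω
  have hDm : ∀ i j, AEMeasurable (D i j) P := fun i j ↦
    ((hB i).aemeasurable _).sub ((hB i).aemeasurable _)
  have hDlaw : ∀ i j, P.map (D i j) = gaussianReal 0 (N : ℝ≥0)⁻¹ := fun i j ↦ by
    have h := ((hB i).hasLaw_sub (τ j.succ) (τ j.castSucc)).map_eq
    have hv : nndist (τ j.succ).1 (τ j.castSucc).1 = (N : ℝ≥0)⁻¹ := by
      apply NNReal.coe_injective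
      have hN0 : (N : ℝ) ≠ 0 := by exact_mod_cast hN.ne'
      have : ((τ j.succ : ℝ≥0) : ℝ) - (τ j.castSucc : ℝ≥0) = (N : ℝ)⁻¹ := by
        simp [τ]; field_simp; ring
      change dist ((τ j.succ : ℝ≥0) : ℝ) (τ j.castSucc : ℝ≥0) = _
      rw [Real.dist_eq, this]
      simp
    rw [hv] at h
    exact h
  have : IsProbabilityMeasure P := hind.isProbabilityMeasure
  have hrow : ∀ i, P.map (fun ω j ↦ D i j ω) = Measure.pi fun _ ↦ gaussianReal 0 (N : ℝ≥0)⁻¹ := by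
    intro i
    have := (hB i).hasIndepIncrements N τ hτ
    rw [iIndepFun_iff_map_fun_eq_pi_map (fun j ↦ hDm i j)] at this
    rw [this]
    congr 1
    funext j
    exact hDlaw i j
  have hrowm : ∀ i, AEMeasurable (fun ω j ↦ D i j ω) P := fun i ↦
    aemeasurable_pi_lambda _ fun j ↦ hDm i j
  have hall : P.map (fun ω i j ↦ D i j ω) = incrementLaw N := by
    have h := hind.comp (fun _ (f : ℝ≥0 → ℝ) (j : Fin N) ↦ f (τ j.succ) - f (τ j.castSucc))
      (fun _ ↦ by fun_prop)
    have h' := (iIndepFun_iff_map_fun_eq_pi_map (f := fun i ω j ↦ D i j ω) hrowm).1 h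
    rw [h']
    unfold incrementLaw
    congr 1
    funext i
    exact hrow i
  have hDall : AEMeasurable (fun ω i j ↦ D i j ω) P := aemeasurable_pi_lambda _ hrowm
  rw [discreteWiener, ← hall, AEMeasurable.map_map_of_aemeasurable
    (measurable_path N).aemeasurable hDall]
  apply Measure.map_congr
  have h0 : ∀ᵐ ω ∂P, ∀ i, B i 0 ω = 0 := ae_all_iff.2 fun i ↦ (hB i).eval_zero_ae_eq_zero
  filter_upwards [h0] with ω hω
  simp only [Function.comp]
  congr 1
  funext k
  unfold walk
  congr 1
  funext i
  change B i (τ k) ω = _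
  induction k using Fin.induction with
  | zero => simp [τ, hω]
  | succ j ih => rw [Fin.partialSum_succ, ← ih]; simp [D]

end ConfinedBM

end

noncomputable section

namespace ConfinedBM

/-! In the increments `ξ` the reweighted law is a centred Gaussian: its unnormalized density is `exp
(-A(ξ, ξ) / 2)`, where `A` (`precision`) is the Dirichlet energy plus `2β` times the confinement. A
linear functional `l` with `l² ≤ K A` then has variance at most `K`, so the theorem reduces to a
deterministic inequality for the coordinates of the path at time `t`.

That inequality is `norm_evalWalk_sq_le`. Finite energy makes the path Hölder-1/2, small confinement
makes it close in L² to one of its own values, and averaging over a time window of length of order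
`1/√β` balances the two into `16/√β` times `A`. Starting at the origin removes the unknown value.

The variance bound needs no determinant or matrix inverse: `l` is represented as `A(w, ·)`, the
Cameron-Martin shift by `w` gives the exponential moment (`lintegral_exp_precision`), and this
dominates the second moment at the cost of a constant (`lintegral_sq_le`). -/

/-! ### Cameron-Martin formula for the increments -/

theorem lintegral_pi_prod {ι : Type*} [Fintype ι] {X : ι → Type*} [∀ i, MeasurableSpace (X i)]
    (μ : ∀ i, Measure (X i)) [∀ i, IsProbabilityMeasure (μ i)] {f : ∀ i, X i → ℝ≥0∞}
    (hf : ∀ i, Measurable (f i)) :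
    ∫⁻ x, ∏ i, f i (x i) ∂Measure.pi μ = ∏ i, ∫⁻ x, f i x ∂μ i := by
  have hind : iIndepFun (fun i (x : ∀ i, X i) ↦ f i (x i)) (Measure.pi μ) :=
    iIndepFun_pi fun i ↦ (hf i).aemeasurable
  have h := lintegral_prod_eq_prod_lintegral_of_indepFun Finset.univ
    (fun i (x : ∀ i, X i) ↦ f i (x i)) hind (fun i ↦ (hf i).comp (measurable_pi_apply i))
  rw [h]
  refine Finset.prod_congr rfl fun i _ ↦ ?_
  exact (measurePreserving_eval μ i).lintegral_comp (hf i)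

theorem pi_withDensity {ι : Type*} [Fintype ι] {X : ι → Type*} [∀ i, MeasurableSpace (X i)]
    (μ : ∀ i, Measure (X i)) [∀ i, IsProbabilityMeasure (μ i)] {f : ∀ i, X i → ℝ≥0∞}
    (hf : ∀ i, Measurable (f i)) [∀ i, SigmaFinite ((μ i).withDensity (f i))] :
    Measure.pi (fun i ↦ (μ i).withDensity (f i)) =
      (Measure.pi μ).withDensity fun x ↦ ∏ i, f i (x i) := by
  refine Measure.pi_eq fun s hs ↦ ?_
  rw [withDensity_apply _ (MeasurableSet.univ_pi hs),
    ← lintegral_indicator (MeasurableSet.univ_pi hs)]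
  have : (Set.univ.pi s).indicator (fun x : ∀ i, X i ↦ ∏ i, f i (x i)) =
      fun x ↦ ∏ i, (s i).indicator (f i) (x i) := by
    funext x
    by_cases hx : x ∈ Set.univ.pi s
    · rw [Set.indicator_of_mem hx]
      exact Finset.prod_congr rfl fun i _ ↦
        (Set.indicator_of_mem (hx i (Set.mem_univ i)) _).symm
    · rw [Set.indicator_of_notMem hx]
      obtain ⟨i, hi⟩ : ∃ i, x i ∉ s i := by simpa [Set.mem_pi] using hx
      exact (Finset.prod_eq_zero (Finset.mem_univ i) (Set.indicator_of_notMem hi _)).symm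
  rw [this, lintegral_pi_prod μ fun i ↦ (hf i).indicator (hs i)]
  refine Finset.prod_congr rfl fun i _ ↦ ?_
  rw [lintegral_indicator (hs i), withDensity_apply _ (hs i)]

/-- The density of a translated centred Gaussian with respect to the original. -/
theorem gaussianReal_eq_withDensity (m : ℝ) {v : ℝ≥0} (hv : v ≠ 0) :
    gaussianReal m v = (gaussianReal 0 v).withDensity
      fun x ↦ ENNReal.ofReal (Real.exp (m * x / v - m ^ 2 / (2 * v))) := by
  rw [gaussianReal_of_var_ne_zero _ hv, gaussianReal_of_var_ne_zero _ hv,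
    ← withDensity_mul _ (measurable_gaussianPDF 0 v) (by fun_prop)]
  congr 1
  funext x
  have hv' : (v : ℝ) ≠ 0 := by exact_mod_cast hv
  simp only [Pi.mul_apply, gaussianPDF, gaussianPDFReal]
  rw [← ENNReal.ofReal_mul (by positivity), mul_assoc (√(2 * Real.pi * v))⁻¹, ← Real.exp_add]
  congr 3
  field_simp
  ring

/-- The Cameron-Martin formula for independent centred Gaussians. -/
theorem map_add_pi_gaussianReal {ι : Type*} [Fintype ι] {v : ℝ≥0} (hv : v ≠ 0) (w : ι → ℝ) :
    (Measure.pi fun _ : ι ↦ gaussianReal 0 v).map (fun x ↦ x + w) =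
      (Measure.pi fun _ : ι ↦ gaussianReal 0 v).withDensity fun x ↦
        ENNReal.ofReal (Real.exp ((∑ i, w i * x i) / v - (∑ i, w i ^ 2) / (2 * v))) := by
  have h1 : (Measure.pi fun _ : ι ↦ gaussianReal 0 v).map (fun x ↦ x + w) =
      Measure.pi fun i ↦ gaussianReal (w i) v := by
    have := Measure.pi_map_pi (μ := fun _ : ι ↦ gaussianReal 0 v)
      (f := fun i x ↦ x + w i) fun i ↦ (measurable_add_const (w i)).aemeasurable
    simp only [gaussianReal_map_add_const, zero_add] at this
    exact this
  have hfin : ∀ i, IsProbabilityMeasure ((gaussianReal 0 v).withDensity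
      fun x ↦ ENNReal.ofReal (Real.exp (w i * x / v - w i ^ 2 / (2 * v)))) := fun i ↦ by
    rw [← gaussianReal_eq_withDensity _ hv]; infer_instance
  rw [h1]
  simp_rw [fun i ↦ gaussianReal_eq_withDensity (w i) hv]
  rw [pi_withDensity _ fun i ↦ by fun_prop]
  congr 1
  funext x
  rw [← ENNReal.ofReal_prod_of_nonneg fun _ _ ↦ (Real.exp_pos _).le, ← Real.exp_sum,
    Finset.sum_sub_distrib, Finset.sum_div, Finset.sum_div]

theorem map_add_incrementLaw {N : ℕ} (hN : 0 < N) (w : Fin 3 → Fin N → ℝ) :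
    (incrementLaw N).map (fun ξ ↦ ξ + w) = (incrementLaw N).withDensity fun ξ ↦
      ENNReal.ofReal (Real.exp (N * (∑ i, ∑ j, w i j * ξ i j) -
        N * (∑ i, ∑ j, w i j ^ 2) / 2)) := by
  have hv : (N : ℝ≥0)⁻¹ ≠ 0 := by positivity
  have hmap : ∀ i, (Measure.pi fun _ : Fin N ↦ gaussianReal 0 (N : ℝ≥0)⁻¹).map
      (fun x ↦ x + w i) = _ := fun i ↦ map_add_pi_gaussianReal hv (w i)
  have hfin : ∀ i, IsProbabilityMeasure ((Measure.pi fun _ : Fin N ↦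
      gaussianReal 0 (N : ℝ≥0)⁻¹).withDensity fun x ↦ ENNReal.ofReal (Real.exp
        ((∑ j, w i j * x j) / ((N : ℝ≥0)⁻¹ : ℝ≥0) -
          (∑ j, w i j ^ 2) / (2 * ((N : ℝ≥0)⁻¹ : ℝ≥0))))) := fun i ↦ by
    rw [← hmap]
    exact Measure.isProbabilityMeasure_map (by fun_prop)
  unfold incrementLaw
  have := Measure.pi_map_pi (μ := fun _ : Fin 3 ↦ Measure.pi fun _ : Fin N ↦
    gaussianReal 0 (N : ℝ≥0)⁻¹) (f := fun i x ↦ x + w i) fun i ↦ by fun_prop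
  simp_rw [hmap] at this
  refine Eq.trans this ?_
  rw [pi_withDensity _ fun i ↦ by fun_prop]
  congr 1
  funext x
  rw [← ENNReal.ofReal_prod_of_nonneg fun _ _ ↦ (Real.exp_pos _).le, ← Real.exp_sum,
    Finset.sum_sub_distrib, ← Finset.sum_div, ← Finset.sum_div]
  have : (N : ℝ) ≠ 0 := by positivity
  congr 3
  · push_cast; field_simp
  · push_cast; field_simp

theorem lintegral_add_incrementLaw {N : ℕ} (hN : 0 < N) (w : Fin 3 → Fin N → ℝ)
    {G : (Fin 3 → Fin N → ℝ) → ℝ≥0∞} (hG : Measurable G) :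
    ∫⁻ ξ, G (ξ + w) ∂incrementLaw N = ∫⁻ ξ, ENNReal.ofReal (Real.exp
      (N * (∑ i, ∑ j, w i j * ξ i j) - N * (∑ i, ∑ j, w i j ^ 2) / 2)) * G ξ
        ∂incrementLaw N := by
  rw [← lintegral_map hG (by fun_prop : Measurable fun ξ ↦ ξ + w), map_add_incrementLaw hN,
    lintegral_withDensity_eq_lintegral_mul _ (by fun_prop) hG]
  rfl

/-! ### The interpolated walk as a linear function of its increments -/

/-- Truncation of a real number to `[0, 1]`. -/
def clamp (y : ℝ) : ℝ := max 0 (min 1 y)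

theorem clamp_sub_clamp_mem {x y : ℝ} (h : x ≤ y) : clamp y - clamp x ∈ Set.Icc (0 : ℝ) 1 := by
  simp only [clamp, Set.mem_Icc, max_def, min_def]
  split_ifs <;> constructor <;> linarith

theorem tent_eq_clamp_sub_clamp (y : ℝ) : max 0 (1 - |y - 1|) = clamp y - clamp (y - 1) := by
  rcases abs_cases (y - 1) with ⟨h, h'⟩ | ⟨h, h'⟩ <;> rw [h] <;> simp only [clamp, max_def, min_def]
    <;> split_ifs <;> linarith

theorem sum_clamp_sub (n : ℕ) {y : ℝ} (hy : 0 ≤ y) :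
    ∑ j ∈ Finset.range n, clamp (y - j) = min (n : ℝ) y := by
  induction n with
  | zero => simp [hy]
  | succ n ih =>
    rw [Finset.sum_range_succ, ih]
    push_cast
    simp only [clamp, max_def, min_def]
    split_ifs <;> linarith

/-- Summation by parts: each tent is a difference of consecutive clamps, so the weights that
multiply `a j` telescope. The boundary term `clamp (y - m)` vanishes for `y ≤ m`, but the induction
lowers `m` with `y` fixed and needs it. -/
theorem sum_tent_mul_partialSum {m : ℕ} (a : Fin m → ℝ) {y : ℝ} :
    ∑ k : Fin (m + 1), max 0 (1 - |y - (k : ℕ)|) * Fin.partialSum a k =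
      ∑ j : Fin m, (clamp (y - (j : ℕ)) - clamp (y - m)) * a j := by
  induction m with
  | zero => simp
  | succ m ih =>
    rw [Fin.sum_univ_castSucc]
    have hp : ∀ k : Fin (m + 1), Fin.partialSum a k.castSucc = Fin.partialSum (Fin.init a) k :=
      fun k ↦ (Fin.partialSum_init k).symm
    have hl : Fin.partialSum a (Fin.last (m + 1)) = ∑ j, a j := by
      rw [Fin.partialSum, List.take_of_length_le (by simp), List.sum_ofFn]
    have ht := tent_eq_clamp_sub_clamp (y - m)
    rw [sub_sub] at ht
    simp only [hp, hl, Fin.val_castSucc, Fin.val_last]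
    rw [ih, Fin.sum_univ_castSucc, Fin.sum_univ_castSucc]
    push_cast
    rw [ht]
    simp only [Fin.init, Fin.val_castSucc]
    rw [mul_add, ← add_assoc, Finset.mul_sum, ← Finset.sum_add_distrib]
    congr 1
    refine Finset.sum_congr rfl fun j _ ↦ ?_
    ring

/-- The value at time `t` of the interpolated walk, as a linear map in the increments. -/
def evalWalk (N : ℕ) (t : ℝ) : (Fin 3 → Fin N → ℝ) →ₗ[ℝ] E3 where
  toFun ξ := WithLp.toLp 2 fun i ↦ ∑ j : Fin N, clamp (N * t - (j : ℕ)) * ξ i j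
  map_add' ξ ζ := by ext i; simp [mul_add, Finset.sum_add_distrib]
  map_smul' c ξ := by
    ext i
    simp only [PiLp.smul_apply, Pi.smul_apply, smul_eq_mul, Finset.mul_sum, RingHom.id_apply]
    exact Finset.sum_congr rfl fun j _ ↦ by ring

theorem evalWalk_apply (N : ℕ) (t : ℝ) (ξ : Fin 3 → Fin N → ℝ) (i : Fin 3) :
    evalWalk N t ξ i = ∑ j : Fin N, clamp (N * t - (j : ℕ)) * ξ i j := rfl

theorem interpolate_walk (N : ℕ) (ξ : Fin 3 → Fin N → ℝ) (t : unitInterval) :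
    interpolate N (walk N ξ) t = evalWalk N t ξ := by
  change ∑ k : Fin (N + 1), hat N k t • walk N ξ k = _
  ext i
  have h := sum_tent_mul_partialSum (ξ i) (y := N * t)
  have hc : clamp (N * (t : ℝ) - N) = 0 := by
    have : (N : ℝ) * t ≤ N * 1 := by gcongr; exact t.2.2
    rw [clamp, max_eq_left]
    exact (min_le_right _ _).trans (by linarith)
  rw [hc] at h
  simp only [sub_zero] at h
  rw [evalWalk_apply, ← h]
  simp [walk, hat]

/-! ### Pointwise bound by energy and confinement -/

/-- The Dirichlet energy `N ∑ |ξ|²` of the interpolated walk with increments `ξ`. -/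
def energy (N : ℕ) (ξ : Fin 3 → Fin N → ℝ) : ℝ := N * ∑ i, ∑ j, ξ i j ^ 2

theorem energy_nonneg (N : ℕ) (ξ : Fin 3 → Fin N → ℝ) : 0 ≤ energy N ξ := by
  unfold energy; positivity

/-- Cauchy-Schwarz in the increments. The weights lie in `[0, 1]`, so their squares sum to at most
their sum `N (t - s)`. -/
theorem norm_evalWalk_sub_sq_le_of_le {N : ℕ} (ξ : Fin 3 → Fin N → ℝ) {s t : unitInterval}
    (h : s ≤ t) : ‖evalWalk N t ξ - evalWalk N s ξ‖ ^ 2 ≤ ((t : ℝ) - s) * energy N ξ := by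
  have hst : (N : ℝ) * s ≤ N * t := by gcongr
  have hd : ∀ j : Fin N, clamp (N * t - (j : ℕ)) - clamp (N * s - (j : ℕ)) ∈ Set.Icc (0 : ℝ) 1 :=
    fun j ↦ clamp_sub_clamp_mem (by linarith)
  have hsum : ∀ u : unitInterval, ∑ j : Fin N, clamp (N * u - (j : ℕ)) = N * u := fun u ↦ by
    rw [Fin.sum_univ_eq_sum_range fun j : ℕ ↦ clamp (N * u - j),
      sum_clamp_sub _ (mul_nonneg N.cast_nonneg u.2.1), min_eq_right]
    have : (N : ℝ) * u ≤ N * 1 := by gcongr; exact u.2.2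
    linarith
  have hsq : ∑ j : Fin N, (clamp (N * t - (j : ℕ)) - clamp (N * s - (j : ℕ))) ^ 2 ≤
      N * (t - s) := by
    calc _ ≤ ∑ j : Fin N, (clamp (N * t - (j : ℕ)) - clamp (N * s - (j : ℕ))) :=
          Finset.sum_le_sum fun j _ ↦ by nlinarith [(hd j).1, (hd j).2]
      _ = N * (t - s) := by rw [Finset.sum_sub_distrib, hsum, hsum, mul_sub]
  rw [EuclideanSpace.norm_sq_eq, energy, Finset.mul_sum, Finset.mul_sum]
  refine Finset.sum_le_sum fun i _ ↦ ?_
  rw [PiLp.sub_apply, evalWalk_apply, evalWalk_apply, ← Finset.sum_sub_distrib, Real.norm_eq_abs,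
    sq_abs]
  simp_rw [← sub_mul]
  refine (Finset.sum_mul_sq_le_sq_mul_sq _ _ _).trans ?_
  rw [← mul_assoc, mul_comm ((t : ℝ) - s)]
  gcongr

theorem norm_evalWalk_sub_sq_le {N : ℕ} (ξ : Fin 3 → Fin N → ℝ) (s t : unitInterval) :
    ‖evalWalk N t ξ - evalWalk N s ξ‖ ^ 2 ≤ |(t : ℝ) - s| * energy N ξ := by
  rcases le_total s t with h | h
  · rw [abs_of_nonneg (sub_nonneg.2 (Subtype.coe_le_coe.2 h))]
    exact norm_evalWalk_sub_sq_le_of_le ξ h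
  · rw [norm_sub_rev, abs_sub_comm, abs_of_nonneg (sub_nonneg.2 (Subtype.coe_le_coe.2 h))]
    exact norm_evalWalk_sub_sq_le_of_le ξ h

/-- A point of `[0, 1]` lies in a subinterval of prescribed length. -/
theorem exists_Icc_near (t : unitInterval) {h : ℝ} (h0 : 0 ≤ h) (h1 : h ≤ 1) :
    ∃ a b : unitInterval, (b : ℝ) - a = h / 2 ∧ ∀ s ∈ Set.Icc a b, |(t : ℝ) - (s : ℝ)| ≤ h / 2 := by
  -- As `h / 2 ≤ 1 / 2`, the window fits to the right of `t` or to its left.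
  rcases le_total (t : ℝ) (1 / 2) with ht | ht
  · refine ⟨t, ⟨t + h / 2, by linarith [t.2.1], by linarith⟩, by simp, fun s hs ↦ ?_⟩
    have h1 : (t : ℝ) ≤ s := hs.1
    have h2 : (s : ℝ) ≤ t + h / 2 := hs.2
    rw [abs_le]; constructor <;> linarith
  · refine ⟨⟨t - h / 2, by linarith, by linarith [t.2.2]⟩, t, by simp, fun s hs ↦ ?_⟩
    have h1 : (t : ℝ) - h / 2 ≤ s := hs.1
    have h2 : (s : ℝ) ≤ t := hs.2
    rw [abs_le]; constructor <;> linarith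

/-- A Sobolev-type inequality: a path with a Hölder-`1/2` bound is pointwise controlled by its
distance in `L²` to a constant. -/
theorem norm_sub_sq_le_of_holder (B : Path3) {D : ℝ}
    (hB : ∀ s t : unitInterval, ‖B t - B s‖ ^ 2 ≤ |(t : ℝ) - s| * D) (c : E3) (hD : 0 ≤ D) {h : ℝ}
    (h0 : 0 < h) (h1 : h ≤ 1) (t : unitInterval) :
    ‖B t - c‖ ^ 2 ≤ h * D + 4 / h * ∫ s, ‖B s - c‖ ^ 2 := by
  obtain ⟨a, b, hab, hnear⟩ := exists_Icc_near t h0.le h1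
  have hcont : Continuous fun s ↦ ‖B s - c‖ ^ 2 := by fun_prop
  have hint : Integrable (fun s ↦ ‖B s - c‖ ^ 2) (volume : Measure unitInterval) :=
    hcont.integrable_of_hasCompactSupport (HasCompactSupport.of_compactSpace _)
  -- The triangle inequality with `(x + y)² ≤ 2x² + 2y²`; averaging it over the window, of length `h
  -- / 2`, turns the factor 2 into `4 / h`.
  have hpt : ∀ s ∈ Set.Icc a b, ‖B t - c‖ ^ 2 ≤ h * D + 2 * ‖B s - c‖ ^ 2 := fun s hs ↦ by
    have e1 : ‖B t - c‖ ≤ ‖B t - B s‖ + ‖B s - c‖ := norm_sub_le_norm_sub_add_norm_sub _ _ _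
    have e2 : |(t : ℝ) - s| * D ≤ h / 2 * D := by gcongr; exact hnear s hs
    have e3 := hB s t
    nlinarith [sq_nonneg (‖B t - B s‖ - ‖B s - c‖), norm_nonneg (B t - c)]
  have hvol : (volume (Set.Icc a b)).toReal = h / 2 := by
    rw [unitInterval.volume_Icc, hab, ENNReal.toReal_ofReal (by positivity)]
  have hmono : ∫ _ in Set.Icc a b, ‖B t - c‖ ^ 2 ≤
      ∫ s in Set.Icc a b, (h * D + 2 * ‖B s - c‖ ^ 2) :=
    setIntegral_mono_on (integrable_const _).integrableOn
      ((integrable_const _).add (hint.const_mul 2)).integrableOn measurableSet_Icc hpt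
  have hle : ∫ s in Set.Icc a b, ‖B s - c‖ ^ 2 ≤ ∫ s, ‖B s - c‖ ^ 2 :=
    setIntegral_le_integral hint (Filter.Eventually.of_forall fun s ↦ by positivity)
  rw [integral_add (integrable_const _) (hint.const_mul 2).integrableOn, integral_const_mul 2,
    setIntegral_const, setIntegral_const, Measure.real, hvol, smul_eq_mul,
    smul_eq_mul] at hmono
  have : ‖B t - c‖ ^ 2 = 2 / h * (h / 2 * ‖B t - c‖ ^ 2) := by field_simp
  rw [this]
  calc _ ≤ 2 / h * (h / 2 * (h * D) + 2 * ∫ s, ‖B s - c‖ ^ 2) := by gcongr; linarith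
    _ = _ := by field_simp; ring

/-- The confinement is the mean of the left side over `r`, and some value does not exceed the mean.
-/
theorem exists_integral_norm_sub_sq_le (B : Path3) :
    ∃ r, ∫ s, ‖B s - B r‖ ^ 2 ≤ confinement B := by
  refine exists_le_integral (μ := (volume : Measure unitInterval))
    (f := fun r ↦ ∫ s, ‖B s - B r‖ ^ 2) ?_
  refine Continuous.integrable_of_hasCompactSupport ?_ (HasCompactSupport.of_compactSpace _)
  have h : Continuous (Function.uncurry fun r s : unitInterval ↦ ‖B s - B r‖ ^ 2) := by
    unfold Function.uncurry; fun_prop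
  simpa using continuous_parametric_integral_of_continuous h isCompact_univ

theorem norm_sq_le_of_holder (B : Path3) (hB0 : B 0 = 0) {D : ℝ} (hD : 0 ≤ D)
    (hB : ∀ s t : unitInterval, ‖B t - B s‖ ^ 2 ≤ |(t : ℝ) - s| * D) {β : ℝ} (hβ : 1 ≤ β)
    (t : unitInterval) :
    ‖B t‖ ^ 2 ≤ 16 / √β * (D + β * confinement B) := by
  obtain ⟨r, hr⟩ := exists_integral_norm_sub_sq_le B
  have hs : 1 ≤ √β := Real.one_le_sqrt.2 hβ
  have hs0 : 0 < √β := by linarith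
  -- The window `h = 1 / √β` gives `D` and `β * confinement B` the same prefactor.
  have hpt : ∀ t, ‖B t - B r‖ ^ 2 ≤ 1 / √β * (D + 4 * (β * confinement B)) := fun t ↦ by
    refine (norm_sub_sq_le_of_holder B hB (B r) hD (h := 1 / √β) (by positivity)
      ((div_le_one hs0).2 hs) t).trans ?_
    calc _ ≤ 1 / √β * D + 4 / (1 / √β) * confinement B := by gcongr
      _ = 1 / √β * (D + 4 * (√β ^ 2 * confinement B)) := by field_simp
      _ = _ := by rw [Real.sq_sqrt (by linarith)]
  -- Since `B 0 = 0`, the bound at time 0 controls `B r` itself.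
  have e1 : ‖B t‖ ≤ ‖B t - B r‖ + ‖B 0 - B r‖ := by
    simpa [hB0] using norm_sub_le (B t - B r) (B 0 - B r)
  have e2 : ‖B t‖ ^ 2 ≤ 4 * (1 / √β * (D + 4 * (β * confinement B))) := by
    nlinarith [sq_nonneg (‖B t - B r‖ - ‖B 0 - B r‖), norm_nonneg (B t), hpt t, hpt 0]
  refine e2.trans ?_
  have : 0 ≤ 1 / √β * D := by positivity
  calc _ ≤ 4 * (1 / √β * (D + 4 * (β * confinement B))) + 12 * (1 / √β * D) := by linarith
    _ = _ := by ring

theorem norm_evalWalk_sq_le {N : ℕ} (ξ : Fin 3 → Fin N → ℝ) {β : ℝ} (hβ : 1 ≤ β)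
    (t : unitInterval) :
    ‖evalWalk N t ξ‖ ^ 2 ≤
      16 / √β * (energy N ξ + β * confinement (interpolate N (walk N ξ))) := by
  have h0 : interpolate N (walk N ξ) 0 = 0 := by
    rw [interpolate_walk]
    ext i
    rw [evalWalk_apply]
    refine Finset.sum_eq_zero fun j _ ↦ ?_
    have : clamp (N * ((0 : unitInterval) : ℝ) - (j : ℕ)) = 0 := by
      rw [clamp, max_eq_left]
      exact (min_le_right _ _).trans (by simp)
    rw [this, zero_mul]
  have := norm_sq_le_of_holder (interpolate N (walk N ξ)) h0 (energy_nonneg N ξ)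
    (fun s t ↦ by simp only [interpolate_walk]; exact norm_evalWalk_sub_sq_le ξ s t) hβ t
  rwa [interpolate_walk] at this

theorem continuous_evalWalk (N : ℕ) (ξ : Fin 3 → Fin N → ℝ) :
    Continuous fun t : unitInterval ↦ evalWalk N t ξ := by
  simp_rw [← interpolate_walk]
  exact (interpolate N (walk N ξ)).continuous

/-! ### The precision form -/

/-- The increment of the interpolated walk between two times. -/
def incWalk (N : ℕ) (z : unitInterval × unitInterval) : (Fin 3 → Fin N → ℝ) →ₗ[ℝ] E3 :=
  evalWalk N z.2 - evalWalk N z.1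

theorem integrable_inner_incWalk (N : ℕ) (ξ ζ : Fin 3 → Fin N → ℝ) :
    Integrable fun z : unitInterval × unitInterval ↦
      inner ℝ (incWalk N z ξ) (incWalk N z ζ) := by
  refine Continuous.integrable_of_hasCompactSupport ?_ (HasCompactSupport.of_compactSpace _)
  have h : ∀ ξ, Continuous fun z ↦ incWalk N z ξ := fun ξ ↦
    ((continuous_evalWalk N ξ).comp continuous_snd).sub
      ((continuous_evalWalk N ξ).comp continuous_fst)
  exact (h ξ).inner (h ζ)

/-- The precision form of the confined walk, as a bilinear form in the increments. -/
def precision (N : ℕ) (β : ℝ) : LinearMap.BilinForm ℝ (Fin 3 → Fin N → ℝ) :=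
  LinearMap.mk₂ ℝ (fun ξ ζ ↦ N * (∑ i, ∑ j, ξ i j * ζ i j) +
      2 * β * ∫ z, inner ℝ (incWalk N z ξ) (incWalk N z ζ))
    (fun ξ ξ' ζ ↦ by
      simp only [map_add, inner_add_left, Pi.add_apply, add_mul, Finset.sum_add_distrib]
      rw [integral_add (integrable_inner_incWalk N ξ ζ) (integrable_inner_incWalk N ξ' ζ)]
      ring)
    (fun c ξ ζ ↦ by
      simp only [map_smul, real_inner_smul_left, Pi.smul_apply, smul_eq_mul, mul_assoc,
        integral_const_mul, ← Finset.mul_sum]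
      ring)
    (fun ξ ζ ζ' ↦ by
      simp only [map_add, inner_add_right, Pi.add_apply, mul_add, Finset.sum_add_distrib]
      rw [integral_add (integrable_inner_incWalk N ξ ζ) (integrable_inner_incWalk N ξ ζ')]
      ring)
    (fun c ξ ζ ↦ by
      simp only [map_smul, real_inner_smul_right, Pi.smul_apply, smul_eq_mul, mul_left_comm _ c,
        integral_const_mul, ← Finset.mul_sum]
      ring)

theorem precision_apply (N : ℕ) (β : ℝ) (ξ ζ : Fin 3 → Fin N → ℝ) :
    precision N β ξ ζ = N * (∑ i, ∑ j, ξ i j * ζ i j) +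
      2 * β * ∫ z, inner ℝ (incWalk N z ξ) (incWalk N z ζ) := rfl

theorem precision_comm (N : ℕ) (β : ℝ) (ξ ζ : Fin 3 → Fin N → ℝ) :
    precision N β ξ ζ = precision N β ζ ξ := by
  simp only [precision_apply, real_inner_comm, mul_comm]

/-- Half of this is the full exponent of the reweighted density, Gaussian part included; hence the
factor `2 * β`. -/
theorem precision_self (N : ℕ) (β : ℝ) (ξ : Fin 3 → Fin N → ℝ) :
    precision N β ξ ξ =
      energy N ξ + 2 * β * confinement (interpolate N (walk N ξ)) := by
  have h : Integrable (Function.uncurry fun s t : unitInterval ↦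
      ‖evalWalk N t ξ - evalWalk N s ξ‖ ^ 2) (volume.prod volume) := by
    refine (integrable_inner_incWalk N ξ ξ).congr (Filter.Eventually.of_forall fun z ↦ ?_)
    exact real_inner_self_eq_norm_sq _
  rw [precision_apply, energy, confinement]
  simp only [interpolate_walk]
  rw [integral_integral h]
  simp only [real_inner_self_eq_norm_sq, ← pow_two]
  rfl

theorem energy_le_precision_self (N : ℕ) {β : ℝ} (hβ : 0 ≤ β) (ξ : Fin 3 → Fin N → ℝ) :
    energy N ξ ≤ precision N β ξ ξ := by
  rw [precision_self]
  have := mul_nonneg hβ (confinement_nonneg (interpolate N (walk N ξ)))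
  linarith

theorem energy_eq_zero {N : ℕ} {ξ : Fin 3 → Fin N → ℝ} (h : energy N ξ ≤ 0) :
    ξ = 0 := by
  funext i j
  have hN : (0 : ℝ) < N := by exact_mod_cast j.pos
  have h1 : ∑ i, ∑ j, ξ i j ^ 2 ≤ 0 := by
    unfold energy at h
    by_contra! hc
    exact absurd h (not_le.2 (mul_pos hN hc))
  have h2 : ξ i j ^ 2 ≤ ∑ i, ∑ j, ξ i j ^ 2 :=
    (Finset.single_le_sum (f := fun j ↦ ξ i j ^ 2) (fun j _ ↦ sq_nonneg _)
      (Finset.mem_univ j)).trans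
    (Finset.single_le_sum (f := fun i ↦ ∑ j, ξ i j ^ 2)
      (fun i _ ↦ Finset.sum_nonneg fun j _ ↦ sq_nonneg _) (Finset.mem_univ i))
  exact pow_eq_zero_iff two_ne_zero |>.1 (le_antisymm (h2.trans h1) (sq_nonneg _))

/-- Every linear functional is represented by the precision form. -/
theorem exists_precision_eq (N : ℕ) {β : ℝ} (hβ : 0 ≤ β)
    (l : (Fin 3 → Fin N → ℝ) →ₗ[ℝ] ℝ) : ∃ w, ∀ ξ, precision N β w ξ = l ξ := by
  -- The form dominates the energy, hence is definite; equality of dimensions then gives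
  -- surjectivity onto the dual.
  have hinj : Function.Injective (precision N β) := by
    rw [injective_iff_map_eq_zero]
    intro ξ hξ
    refine energy_eq_zero ((energy_le_precision_self N hβ ξ).trans ?_)
    rw [hξ, LinearMap.zero_apply]
  have hsurj : Function.Surjective (precision N β) :=
    (LinearMap.injective_iff_surjective_of_finrank_eq_finrank
      (Subspace.dual_finrank_eq (K := ℝ) (V := Fin 3 → Fin N → ℝ)).symm).1 hinj
  obtain ⟨w, hw⟩ := hsurj l
  exact ⟨w, fun ξ ↦ by rw [hw]⟩

/-! ### Second moments under the reweighted law -/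

/-- The quadratic confinement of the interpolated walk, in terms of the increments. -/
def walkConfinement (N : ℕ) (ξ : Fin 3 → Fin N → ℝ) : ℝ := confinement (interpolate N (walk N ξ))

theorem measurable_walkConfinement (N : ℕ) : Measurable (walkConfinement N) :=
  continuous_confinement.measurable.comp (measurable_path N)

theorem energy_sub (N : ℕ) (ξ w : Fin 3 → Fin N → ℝ) :
    energy N (ξ - w) = energy N ξ - 2 * (N * ∑ i, ∑ j, w i j * ξ i j) + energy N w := by
  simp only [energy, Pi.sub_apply, sub_sq, Finset.sum_add_distrib, Finset.sum_sub_distrib]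
  have : ∀ i, ∑ j, 2 * ξ i j * w i j = 2 * ∑ j, w i j * ξ i j := fun i ↦ by
    rw [Finset.mul_sum]
    exact Finset.sum_congr rfl fun j _ ↦ by ring
  simp only [this, ← Finset.mul_sum]
  ring

/-- The moment generating function of the confined walk. -/
theorem lintegral_exp_precision {N : ℕ} (hN : 0 < N) (β : ℝ) (w : Fin 3 → Fin N → ℝ) :
    ∫⁻ ξ, ENNReal.ofReal (Real.exp (precision N β w ξ - β * walkConfinement N ξ))
        ∂incrementLaw N =
      ENNReal.ofReal (Real.exp (precision N β w w / 2)) *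
        ∫⁻ ξ, ENNReal.ofReal (Real.exp (-(β * walkConfinement N ξ))) ∂incrementLaw N := by
  have hm := measurable_walkConfinement N
  -- With this `G` the shift by `w` completes the square: the Cameron-Martin exponent minus `β *
  -- walkConfinement N (ξ - w)` equals `A(w, ξ) - A(w, w) / 2 - β * walkConfinement N ξ`.
  have h := lintegral_add_incrementLaw hN w
    (G := fun ξ ↦ ENNReal.ofReal (Real.exp (-(β * walkConfinement N (ξ - w))))) (by fun_prop)
  simp only [add_sub_cancel_right] at h
  rw [h, ← lintegral_const_mul _ (by fun_prop)]
  refine lintegral_congr fun ξ ↦ ?_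
  rw [← ENNReal.ofReal_mul (Real.exp_pos _).le, ← ENNReal.ofReal_mul (Real.exp_pos _).le,
    ← Real.exp_add, ← Real.exp_add]
  congr 2
  have e1 := precision_self N β ξ
  have e2 := precision_self N β (ξ - w)
  have e3 := energy_sub N ξ w
  have e4 := precision_comm N β ξ w
  simp only [map_sub, LinearMap.sub_apply] at e2
  change _ = _ + 2 * β * walkConfinement N _ at e1
  change _ = _ + 2 * β * walkConfinement N _ at e2
  have e5 : energy N w = N * ∑ i, ∑ j, w i j ^ 2 := rfl
  linarith

theorem sq_le_two_mul_exp_add_exp_neg (x : ℝ) : x ^ 2 ≤ 2 * (Real.exp x + Real.exp (-x)) := by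
  have h := Real.quadratic_le_exp_of_nonneg (abs_nonneg x)
  have h' : Real.exp |x| ≤ Real.exp x + Real.exp (-x) := by
    rcases abs_choice x with hx | hx <;> rw [hx]
    · linarith [Real.exp_pos (-x)]
    · linarith [Real.exp_pos x]
  nlinarith [sq_abs x, abs_nonneg x]

/-- A linear functional that is bounded by the precision form has a small second moment. -/
theorem lintegral_sq_le {N : ℕ} (hN : 0 < N) {β : ℝ} (hβ : 0 ≤ β) {K : ℝ} (hK : 0 < K)
    (l : (Fin 3 → Fin N → ℝ) →ₗ[ℝ] ℝ) (hl : ∀ ξ, l ξ ^ 2 ≤ K * precision N β ξ ξ) :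
    ∫⁻ ξ, ENNReal.ofReal (Real.exp (-(β * walkConfinement N ξ))) * ENNReal.ofReal (l ξ ^ 2)
        ∂incrementLaw N ≤
      ENNReal.ofReal (6 * K) *
        ∫⁻ ξ, ENNReal.ofReal (Real.exp (-(β * walkConfinement N ξ))) ∂incrementLaw N := by
  have hm := measurable_walkConfinement N
  have hlm : Measurable l := l.continuous_of_finiteDimensional.measurable
  obtain ⟨w, hw⟩ := exists_precision_eq N hβ l
  -- This scale makes the exponent `a² * l w / 2` of the exponential moment at most 1.
  set a := √(2 / K)
  have ha : a ^ 2 = 2 / K := Real.sq_sqrt (by positivity)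
  -- `l w = A(w, w)` is the variance of `l`; testing `hl` at `w` gives `(l w)² ≤ K * l w`.
  have hlw : l w ≤ K := by
    have h := hl w
    rw [hw w] at h
    by_contra! hc
    nlinarith
  set Z := ∫⁻ ξ, ENNReal.ofReal (Real.exp (-(β * walkConfinement N ξ))) ∂incrementLaw N
  have hmgf : ∀ c : ℝ, c ^ 2 = 2 / K →
      ∫⁻ ξ, ENNReal.ofReal (Real.exp (c * l ξ - β * walkConfinement N ξ)) ∂incrementLaw N ≤
        ENNReal.ofReal 3 * Z := fun c hc ↦ by
    have h := lintegral_exp_precision hN β (c • w)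
    simp only [map_smul, LinearMap.smul_apply, hw, smul_eq_mul] at h
    rw [h]
    gcongr
    have : c * (c * l w) / 2 ≤ 1 := by
      calc c * (c * l w) / 2 = c ^ 2 * l w / 2 := by ring
        _ ≤ c ^ 2 * K / 2 := by gcongr
        _ = 1 := by rw [hc]; field_simp
    have h3 := Real.exp_le_exp.2 this
    linarith [Real.exp_one_lt_d9]
  have hpt : ∀ ξ, ENNReal.ofReal (Real.exp (-(β * walkConfinement N ξ))) *
      ENNReal.ofReal (l ξ ^ 2) ≤ ENNReal.ofReal K *
        (ENNReal.ofReal (Real.exp (a * l ξ - β * walkConfinement N ξ)) +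
          ENNReal.ofReal (Real.exp (-a * l ξ - β * walkConfinement N ξ))) := fun ξ ↦ by
    rw [← ENNReal.ofReal_mul (Real.exp_pos _).le,
      ← ENNReal.ofReal_add (Real.exp_pos _).le (Real.exp_pos _).le, ← ENNReal.ofReal_mul hK.le]
    apply ENNReal.ofReal_le_ofReal
    have h := sq_le_two_mul_exp_add_exp_neg (a * l ξ)
    rw [mul_pow, ha] at h
    have h' : l ξ ^ 2 ≤ K * (Real.exp (a * l ξ) + Real.exp (-(a * l ξ))) := by
      calc l ξ ^ 2 = K / 2 * (2 / K * l ξ ^ 2) := by field_simp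
        _ ≤ K / 2 * (2 * (Real.exp (a * l ξ) + Real.exp (-(a * l ξ)))) := by gcongr
        _ = _ := by ring
    rw [sub_eq_add_neg, sub_eq_add_neg, Real.exp_add, Real.exp_add, ← add_mul, neg_mul,
      mul_comm, ← mul_assoc]
    gcongr
  calc _ ≤ _ := lintegral_mono hpt
    _ = ENNReal.ofReal K *
        (∫⁻ ξ, ENNReal.ofReal (Real.exp (a * l ξ - β * walkConfinement N ξ)) ∂incrementLaw N +
        ∫⁻ ξ, ENNReal.ofReal (Real.exp (-a * l ξ - β * walkConfinement N ξ)) ∂incrementLaw N) := by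
      rw [lintegral_const_mul _ (by fun_prop), lintegral_add_left (by fun_prop)]
    _ ≤ ENNReal.ofReal K * (ENNReal.ofReal 3 * Z + ENNReal.ofReal 3 * Z) := by
      gcongr
      · exact hmgf a ha
      · exact hmgf (-a) (by rw [neg_sq, ha])
    _ = ENNReal.ofReal (6 * K) * Z := by
      rw [← add_mul, ← ENNReal.ofReal_add (by norm_num) (by norm_num), ← mul_assoc,
        ← ENNReal.ofReal_mul hK.le]
      congr 2
      ring

/-! ### Return to path space -/

theorem lintegral_tilted_le {α : Type*} [MeasurableSpace α] {μ : Measure α} {f : α → ℝ}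
    {g : α → ℝ≥0∞} {c : ℝ≥0∞} (hf : Measurable f) (hg : Measurable g)
    (h : ∫⁻ x, ENNReal.ofReal (Real.exp (f x)) * g x ∂μ ≤
      c * ∫⁻ x, ENNReal.ofReal (Real.exp (f x)) ∂μ) :
    ∫⁻ x, g x ∂μ.tilted f ≤ c := by
  by_cases hint : Integrable (fun x ↦ Real.exp (f x)) μ
  swap
  -- Without integrability the tilted measure is zero by convention.
  · simp [tilted_of_not_integrable hint]
  rcases eq_zero_or_neZero μ with rfl | hμ
  · simp
  have hpos : 0 < ∫ x, Real.exp (f x) ∂μ := integral_exp_pos hint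
  rw [lintegral_tilted]
  rw [← ofReal_integral_eq_lintegral_ofReal hint
    (Filter.Eventually.of_forall fun x ↦ (Real.exp_pos _).le)] at h
  simp_rw [ENNReal.ofReal_div_of_pos hpos, div_eq_mul_inv, mul_right_comm _ _ (g _)]
  rw [lintegral_mul_const _ (by fun_prop), ← div_eq_mul_inv]
  exact ENNReal.div_le_of_le_mul h

/-- Each of the three coordinates contributes at most `6 * K` with `K = 16 / √β`, and `3 * 6 * 16 =
288`. -/
theorem lintegral_confinedLaw_norm_sq_le {N : ℕ} (hN : 0 < N) {β : ℝ} (hβ : 1 ≤ β)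
    (t : unitInterval) :
    ∫⁻ B, ENNReal.ofReal (‖B t‖ ^ 2) ∂confinedLaw N β ≤ ENNReal.ofReal (288 / √β) := by
  have hβ0 : 0 ≤ β := by linarith
  have hs0 : 0 < √β := Real.sqrt_pos.2 (by linarith)
  have hc := continuous_confinement
  have hm := measurable_walkConfinement N
  have hg : Measurable fun B : Path3 ↦ ENNReal.ofReal (‖B t‖ ^ 2) :=
    (by fun_prop : Continuous fun B : Path3 ↦ ‖B t‖ ^ 2).measurable.ennreal_ofReal
  have hf : Measurable fun B : Path3 ↦ -(β * confinement B) :=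
    (continuous_const.mul hc).neg.measurable
  refine lintegral_tilted_le hf hg ?_
  rw [discreteWiener, lintegral_map (by fun_prop) (measurable_path N),
    lintegral_map (by fun_prop) (measurable_path N)]
  change ∫⁻ ξ, ENNReal.ofReal (Real.exp (-(β * walkConfinement N ξ))) * _ ∂incrementLaw N ≤ _ *
    ∫⁻ ξ, ENNReal.ofReal (Real.exp (-(β * walkConfinement N ξ))) ∂incrementLaw N
  let l : Fin 3 → (Fin 3 → Fin N → ℝ) →ₗ[ℝ] ℝ := fun i ↦
    (EuclideanSpace.proj i : E3 →L[ℝ] ℝ).toLinearMap ∘ₗ evalWalk N t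
  have hlm : ∀ i, Measurable (l i) := fun i ↦ (l i).continuous_of_finiteDimensional.measurable
  have hsum : ∀ ξ, ‖evalWalk N t ξ‖ ^ 2 = ∑ i, l i ξ ^ 2 := fun ξ ↦ by
    rw [EuclideanSpace.norm_sq_eq]
    exact Finset.sum_congr rfl fun i _ ↦ by rw [Real.norm_eq_abs, sq_abs]; rfl
  have hl : ∀ i ξ, l i ξ ^ 2 ≤ 16 / √β * precision N β ξ ξ := fun i ξ ↦ by
    calc l i ξ ^ 2 ≤ ‖evalWalk N t ξ‖ ^ 2 := by
          rw [hsum]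
          exact Finset.single_le_sum (f := fun i ↦ l i ξ ^ 2) (fun i _ ↦ sq_nonneg _)
            (Finset.mem_univ i)
      _ ≤ _ := norm_evalWalk_sq_le ξ hβ t
      _ ≤ _ := by
          rw [precision_self]
          have := mul_nonneg hβ0 (confinement_nonneg (interpolate N (walk N ξ)))
          exact mul_le_mul_of_nonneg_left (by linarith) (by positivity)
  simp only [interpolate_walk, hsum]
  simp_rw [ENNReal.ofReal_sum_of_nonneg fun i _ ↦ sq_nonneg _, Finset.mul_sum]
  rw [lintegral_finsetSum _ fun i _ ↦ by fun_prop]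
  refine (Finset.sum_le_sum fun i _ ↦ lintegral_sq_le hN hβ0 (by positivity) (l i) (hl i)).trans ?_
  rw [Finset.sum_const, Finset.card_univ, Fintype.card_fin, ← smul_mul_assoc,
    ← ENNReal.ofReal_nsmul]
  gcongr
  rw [nsmul_eq_mul]
  apply le_of_eq
  push_cast
  ring

end ConfinedBM

end

theorem lemma4p2 :
    ∃ C : ℝ, 0 < C ∧ ∀ β : ℝ, 2 ≤ β →
      ∃ η₀ : ℝ, 0 < η₀ ∧ ∀ N : ℕ, 0 < N → 1 / (N : ℝ) ≤ η₀ →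
        ⨆ t : unitInterval,
            ∫⁻ B, ENNReal.ofReal (‖B t‖ ^ 2) ∂(ConfinedBM.confinedLaw N β) ≤
          ENNReal.ofReal (C / Real.sqrt β) :=
  -- The bound is uniform in the mesh, so `η₀ = 1` serves.
  ⟨288, by norm_num, fun _ hβ ↦ ⟨1, one_pos, fun _ hN _ ↦ iSup_le fun t ↦
    ConfinedBM.lintegral_confinedLaw_norm_sq_le hN (by linarith) t⟩⟩
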